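/- Let $G$ be a finite-dimensional (not necessarily connected) real Lie group with unit element $e$, equipped with a smooth left-invariant Riemannian metric, and let $d$ be the induced Riemannian distance, i.e. the infimum of the lengths of curves; $d(g,h)=\infty$ if $g$ and $h$ lie in different connected components. Let $1\le\alpha\le\infty$ and let $\beta\in[1,\infty]$ be given by $\frac1\alpha+\frac1\beta=1$. For $t>0$ and $r\in[0,\infty]$ put $$\kappa_t^\alpha(r)=\frac{t}{\beta}\Big(\frac{r}{t}\Big)^{\beta}\quad(1<\alpha\le\infty),\qquad \kappa_t^1(r)=\begin{cases}0,& r<t,\\ \infty,& r\ge t,\end{cases}$$ and for $t=0$ put $\kappa_0^\infty(r)=r$ and, for $\alpha<\infty$, $\kappa_0^\alpha(r)=0$ if $r=0$ and $\kappa_0^\alpha(r)=\infty$ if $r>0$. Extend $\kappa_t^\alpha$ to $\mathbb R$ by $\kappa_t^\alpha(x)=\kappa_t^\alpha(|x|)$. The morphological kernel on $G$ is $k_t^\alpha(g)=\kappa_t^\alpha(d(g,e))$ for $t>0$, with $k_0^\infty=d(\cdot,e)$ and, for $\alpha<\infty$, $k_0^\alpha=\delta_e^M$, where $\delta_e^M(e)=0$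 and $\delta_e^M(g)=\infty$ for $g\ne e$. For $[0,\infty]$-valued functions, the morphological convolutions on $G$ and on $\mathbb R$ are $$(f_1\square f_2)(g)=\inf_{h\in G}\{f_1(h^{-1}g)+f_2(h)\},\qquad (f_1\square_{\mathbb R} f_2)(x)=\inf_{r\in\mathbb R}\{f_1(x-r)+f_2(r)\}.$$ Then for all $t,s\ge 0$ and all $g\in G$, $$(k_t^\alpha\,\square\,k_s^\alpha)(g)=k_{t+s}^\alpha(g),$$ and for every $g$ in the connected component of $e$ (so for every $g\in G$ if $G$ is connected) one has $d(g,e)<\infty$ and $$k_{t+s}^\alpha(g)=(\kappa_t^\alpha\,\square_{\mathbb R}\,\kappa_s^\alpha)(d(g,e)).$$ -/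

import Mathlib

open scoped Manifold ContDiff ENNReal NNReal Bundle

noncomputable section

/-- The Riemannian metric on the Lie group `G` is left-invariant: the push-forward
`(L_g)_* : T_h G → T_{gh} G` of every left translation `L_g x = g * x` preserves
the quadratic form of the metric. -/
def IsLeftInvariantMetric {E H G : Type*} [NormedAddCommGroup E] [NormedSpace ℝ E]
    [TopologicalSpace H] (I : ModelWithCorners ℝ E H)
    [TopologicalSpace G] [ChartedSpace H G] [Group G]
    [Bundle.RiemannianBundle (fun x : G => TangentSpace I x)] : Prop :=
  ∀ (g h : G) (v : TangentSpace I h),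
    inner ℝ (mfderiv I I (fun x : G => g * x) h v) (mfderiv I I (fun x : G => g * x) h v)
      = inner ℝ v v

/-- Morphological convolution `(f₁ □ f₂)(g) = inf_{h ∈ G} (f₁ (h⁻¹ g) + f₂ h)` on a group. -/
def morphConv {G : Type*} [Group G] (f₁ f₂ : G → ℝ≥0∞) (g : G) : ℝ≥0∞ :=
  ⨅ h : G, f₁ (h⁻¹ * g) + f₂ h

/-- Morphological convolution on the real line,
`(f₁ □_ℝ f₂)(x) = inf_{r ∈ ℝ} (f₁ (x - r) + f₂ r)`. -/
def morphConvReal (f₁ f₂ : ℝ → ℝ≥0∞) (x : ℝ) : ℝ≥0∞ :=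
  ⨅ r : ℝ, f₁ (x - r) + f₂ r

open Classical in
/-- The morphological delta: `0` at the unit element and `∞` elsewhere. -/
def morphDelta {G : Type*} [Group G] (g : G) : ℝ≥0∞ :=
  if g = 1 then 0 else ⊤

open Classical in
/-- The profile `κ_t^α` as a function of a distance `r ∈ [0, ∞]`. With `1/α + 1/β = 1` it is
`(t/β) (r/t)^β` for `t > 0` and `1 < α ≤ ∞`, and for `α = 1`, `t > 0` it is `0` if `r < t` and
`∞` otherwise. At `t = 0` it is `r` if `α = ∞`, and the delta at `r = 0` if `α < ∞`. -/
def kappa (α : ℝ≥0∞) (t : ℝ≥0) (r : ℝ≥0∞) : ℝ≥0∞ :=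
  if t = 0 then
    if α = ⊤ then r else if r = 0 then 0 else ⊤
  else if α = 1 then
    if r < t then 0 else ⊤
  else
    (t / α.conjExponent) * (r / t) ^ α.conjExponent.toReal

/-- The one-dimensional kernel on the whole real line, `x ↦ κ_t^α(|x|)`. -/
def kappaReal (α : ℝ≥0∞) (t : ℝ≥0) (x : ℝ) : ℝ≥0∞ :=
  kappa α t (ENNReal.ofReal |x|)

open Classical in
/-- The morphological kernel `k_t^α` on a Riemannian Lie group: `k_0^α` is the morphological delta
if `α < ∞`, and in all other cases `k_t^α(g) = κ_t^α(d(g, e))` (in particular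
`k_0^∞ = d(·, e)`), where `d` is the Riemannian distance of the metric. -/
def morphKernel {E H G : Type*} [NormedAddCommGroup E] [NormedSpace ℝ E]
    [TopologicalSpace H] (I : ModelWithCorners ℝ E H)
    [TopologicalSpace G] [ChartedSpace H G] [Group G]
    [Bundle.RiemannianBundle (fun x : G => TangentSpace I x)]
    (α : ℝ≥0∞) (t : ℝ≥0) (g : G) : ℝ≥0∞ :=
  if t = 0 ∧ α ≠ ⊤ then morphDelta g
  else kappa α t (Manifold.riemannianEDist I g 1)

end

/-! ### Profiles: joint subadditivity and infimal convolution. -/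

section Kappa

open Filter Topology

/-! Left invariance turns the convolution into an infimum over `h` of `κ_t (d(g,h)) + κ_s (d(h,e))`.
The triangle inequality and joint subadditivity of the profiles (`kappa_add_le`, a case of Jensen)
bound it below. For the upper bound, `h` is taken on an almost shortest curve, dividing the distance
in the ratio `t : s`, which is the equality case of Jensen. Only these metric facts enter, so
`iInf_kappa_add_kappa` covers both `G` and the real line. -/

lemma kappa_top_left (t : ℝ≥0) (r : ℝ≥0∞) : kappa ⊤ t r = r := by
  rcases eq_or_ne t 0 with rfl | ht
  · simp [kappa]
  · have ht' : (t : ℝ≥0∞) ≠ 0 := by simpa using ht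
    simp [kappa, ht, ENNReal.conjExponent, ENNReal.mul_div_cancel ht' ENNReal.coe_ne_top]

lemma kappa_zero_of_ne_top {α : ℝ≥0∞} (hα : α ≠ ⊤) (r : ℝ≥0∞) :
    kappa α 0 r = if r = 0 then 0 else ⊤ := by
  simp [kappa, hα]

lemma kappa_zero_zero (α : ℝ≥0∞) : kappa α 0 0 = 0 := by
  simp [kappa]

lemma kappa_one {t : ℝ≥0} (ht : t ≠ 0) (r : ℝ≥0∞) :
    kappa 1 t r = if r < t then 0 else ⊤ := by
  simp [kappa, ht]

lemma kappa_of_one_lt {α : ℝ≥0∞} (hα : 1 < α) {t : ℝ≥0} (ht : t ≠ 0) (r : ℝ≥0∞) :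
    kappa α t r = (t / α.conjExponent) * (r / t) ^ α.conjExponent.toReal := by
  simp [kappa, ht, hα.ne']

lemma ENNReal.conjExponent_ne_top_of_one_lt {α : ℝ≥0∞} (hα : 1 < α) : α.conjExponent ≠ ⊤ := by
  simp [ENNReal.conjExponent, tsub_eq_zero_iff_le, hα]

lemma ENNReal.one_le_conjExponent (α : ℝ≥0∞) : 1 ≤ α.conjExponent := le_self_add

lemma ENNReal.one_le_toReal_conjExponent {α : ℝ≥0∞} (hα : 1 < α) :
    1 ≤ α.conjExponent.toReal := by
  simpa using ENNReal.toReal_mono (ENNReal.conjExponent_ne_top_of_one_lt hα)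
    (ENNReal.one_le_conjExponent α)

lemma kappa_mono {α : ℝ≥0∞} (hα : 1 ≤ α) (t : ℝ≥0) : Monotone (kappa α t) := by
  intro r r' h
  rcases eq_or_ne t 0 with rfl | ht
  · rcases eq_or_ne α ⊤ with rfl | hα'
    · simpa [kappa_top_left] using h
    · rw [kappa_zero_of_ne_top hα', kappa_zero_of_ne_top hα']
      split_ifs with h1 h2 h2
      · rfl
      · exact le_top
      · exact absurd (le_antisymm (h.trans h2.le) bot_le) h1
      · rfl
  rcases hα.eq_or_lt with rfl | hα
  · rw [kappa_one ht, kappa_one ht]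
    split_ifs with h1 h2 h2
    · rfl
    · exact le_top
    · exact absurd (h.trans_lt h2) h1
    · rfl
  · rw [kappa_of_one_lt hα ht, kappa_of_one_lt hα ht]
    gcongr

/-- The profiles are subadditive jointly in time and distance. -/
lemma kappa_add_le {α : ℝ≥0∞} (hα : 1 ≤ α) (t s : ℝ≥0) (a b : ℝ≥0∞) :
    kappa α (t + s) (a + b) ≤ kappa α t a + kappa α s b := by
  rcases eq_or_ne α ⊤ with rfl | hα'
  · simp [kappa_top_left]
  rcases eq_or_ne t 0 with rfl | ht
  · rcases eq_or_ne a 0 with rfl | ha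
    · simp
    · simp [kappa_zero_of_ne_top hα', ha]
  rcases eq_or_ne s 0 with rfl | hs
  · rcases eq_or_ne b 0 with rfl | hb
    · simp
    · simp [kappa_zero_of_ne_top hα', hb]
  have hts : t + s ≠ 0 := by simp [ht]
  rcases hα.eq_or_lt with rfl | hα
  · rw [kappa_one ht, kappa_one hs, kappa_one hts]
    by_cases h1 : a < t
    · by_cases h2 : b < s
      · simp [h1, h2, ENNReal.add_lt_add h1 h2]
      · simp [h2]
    · simp [h1]
  · rw [kappa_of_one_lt hα ht, kappa_of_one_lt hα hs, kappa_of_one_lt hα hts]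
    set β := α.conjExponent
    set p := β.toReal
    have hT0 : (t : ℝ≥0∞) ≠ 0 := by simpa using ht
    have hS0 : (s : ℝ≥0∞) ≠ 0 := by simpa using hs
    have hTS0 : ((t + s : ℝ≥0) : ℝ≥0∞) ≠ 0 := by exact_mod_cast hts
    set T : ℝ≥0∞ := (t : ℝ≥0∞)
    set S : ℝ≥0∞ := (s : ℝ≥0∞)
    have hTS : ((t + s : ℝ≥0) : ℝ≥0∞) = T + S := by simp [T, S]
    have hTt : T ≠ ⊤ := ENNReal.coe_ne_top
    have hSt : S ≠ ⊤ := ENNReal.coe_ne_top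
    rw [hTS] at hTS0 ⊢
    have hTSt : T + S ≠ ⊤ := ENNReal.add_ne_top.2 ⟨hTt, hSt⟩
    -- Jensen for the `p`-th power: weights proportional to the times, applied to the speeds `a / T`
    -- and `b / S`.
    have key := ENNReal.rpow_arith_mean_le_arith_mean2_rpow (T / (T + S)) (S / (T + S))
      (a / T) (b / S) (by rw [ENNReal.div_add_div_same, ENNReal.div_self hTS0 hTSt])
      (ENNReal.one_le_toReal_conjExponent hα)
    have e1 : T / (T + S) * (a / T) + S / (T + S) * (b / S) = (a + b) / (T + S) := by
      have e (U c : ℝ≥0∞) (h0 : U ≠ 0) (h1 : U ≠ ⊤) : U / (T + S) * (c / U) = c / (T + S) := by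
        rw [ENNReal.div_eq_inv_mul, mul_assoc, ENNReal.mul_div_cancel h0 h1,
          ENNReal.div_eq_inv_mul]
      rw [e T a hT0 hTt, e S b hS0 hSt, ENNReal.div_add_div_same]
    rw [e1] at key
    calc (T + S) / β * ((a + b) / (T + S)) ^ p
        ≤ (T + S) / β * (T / (T + S) * (a / T) ^ p + S / (T + S) * (b / S) ^ p) := by gcongr
      _ = T / β * (a / T) ^ p + S / β * (b / S) ^ p := by
        have e (U c : ℝ≥0∞) : (T + S) / β * (U / (T + S) * c) = U / β * c := by
          rw [← mul_assoc]
          congr 1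
          rw [mul_comm, ENNReal.div_eq_inv_mul (a := T + S),
            ENNReal.div_eq_inv_mul (a := U) (b := β), mul_left_comm, ENNReal.div_mul_cancel hTS0 hTSt]
        rw [mul_add, e, e]

lemma continuous_kappa {α : ℝ≥0∞} (hα : 1 < α) {t : ℝ≥0} (ht : t ≠ 0) :
    Continuous (kappa α t) := by
  have ht' : (t : ℝ≥0∞) ≠ 0 := by simpa using ht
  have h : kappa α t =
      fun r ↦ (t / α.conjExponent) * (r / t) ^ α.conjExponent.toReal :=
    funext fun r ↦ kappa_of_one_lt hα ht r
  rw [h]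
  have hne : (t : ℝ≥0∞) / α.conjExponent ≠ ⊤ :=
    ENNReal.div_ne_top ENNReal.coe_ne_top
      (zero_lt_one.trans_le (ENNReal.one_le_conjExponent α)).ne'
  exact (ENNReal.continuous_const_mul hne).comp
    (ENNReal.continuous_rpow_const.comp (ENNReal.continuous_div_const _ ht'))

lemma kappa_right_top {α : ℝ≥0∞} (hα : 1 ≤ α) (t : ℝ≥0) : kappa α t ⊤ = ⊤ := by
  rcases eq_or_ne t 0 with rfl | ht
  · simp [kappa]
  rcases hα.eq_or_lt with rfl | hα
  · simp [kappa_one ht]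
  · have h0 : 0 < α.conjExponent.toReal :=
      zero_lt_one.trans_le (ENNReal.one_le_toReal_conjExponent hα)
    have hne : (t : ℝ≥0∞) / α.conjExponent ≠ 0 :=
      (ENNReal.div_pos (by simpa using ht) (ENNReal.conjExponent_ne_top_of_one_lt hα)).ne'
    rw [kappa_of_one_lt hα ht, ENNReal.top_div_coe, ENNReal.top_rpow_of_pos h0,
      ENNReal.mul_top hne]

/-- The profiles form a semigroup for infimal convolution along any pair of functions `a`, `b`
that behave like the distances to the two ends of a (near-)geodesic of length `D`. -/
lemma iInf_kappa_add_kappa {X : Type*} {α : ℝ≥0∞} (hα : 1 ≤ α) (t s : ℝ≥0) (a b : X → ℝ≥0∞)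
    (D : ℝ≥0∞) (hD : ∀ x, D ≤ a x + b x) (hleft : ∃ x, a x = 0 ∧ b x = D)
    (hright : ∃ x, a x = D ∧ b x = 0)
    (hmid : D ≠ ⊤ → ∀ p q, p + q = D → ∀ ε, 0 < ε → ∃ x, b x = q ∧ a x ≤ p + ε) :
    ⨅ x, kappa α t (a x) + kappa α s (b x) = kappa α (t + s) D := by
  apply le_antisymm _ (le_iInf fun x ↦ (kappa_mono hα _ (hD x)).trans (kappa_add_le hα _ _ _ _))
  rcases eq_or_ne t 0 with rfl | ht
  -- At time zero the profile may jump at `0`, so an exact endpoint is needed; an `ε`-approximation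
  -- would not do.
  · obtain ⟨x, hx, hx'⟩ := hleft
    exact (iInf_le _ x).trans (by simp [hx, hx', kappa_zero_zero])
  rcases eq_or_ne s 0 with rfl | hs
  · obtain ⟨x, hx, hx'⟩ := hright
    exact (iInf_le _ x).trans (by simp [hx, hx', kappa_zero_zero])
  rcases eq_or_ne D ⊤ with rfl | hDt
  · rw [kappa_right_top hα]; exact le_top
  have hts : t + s ≠ 0 := by simp [ht]
  have hT0 : (t : ℝ≥0∞) ≠ 0 := by simpa using ht
  have hS0 : (s : ℝ≥0∞) ≠ 0 := by simpa using hs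
  set T : ℝ≥0∞ := (t : ℝ≥0∞) with hT
  set S : ℝ≥0∞ := (s : ℝ≥0∞) with hS
  have hTt : T ≠ ⊤ := ENNReal.coe_ne_top
  have hSt : S ≠ ⊤ := ENNReal.coe_ne_top
  have hTS : ((t + s : ℝ≥0) : ℝ≥0∞) = T + S := by simp [T, S]
  have hTS0 : T + S ≠ 0 := by simp [hT0]
  have hTSt : T + S ≠ ⊤ := ENNReal.add_ne_top.2 ⟨hTt, hSt⟩
  -- Constant speed: both pieces have the same ratio of distance to time.
  have hpq : T * (D / (T + S)) + S * (D / (T + S)) = D := by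
    rw [← add_mul, ENNReal.mul_div_cancel hTS0 hTSt]
  replace hmid := hmid hDt _ _ hpq
  rcases hα.eq_or_lt with rfl | hα
  · rw [kappa_one hts, hTS]
    split_ifs with h
    · have h1 : D / (T + S) < 1 := (ENNReal.div_lt_iff (Or.inl hTS0) (Or.inl hTSt)).2 (by simpa)
      have hlt (U : ℝ≥0∞) (h0 : U ≠ 0) (ht : U ≠ ⊤) : U * (D / (T + S)) < U := by
        simpa using ENNReal.mul_lt_mul_right h0 ht h1
      -- Half the gap below `T` keeps the inequality strict, as the profile for `α = 1` requires.
      obtain ⟨x, hx, hx'⟩ := hmid ((T - T * (D / (T + S))) / 2)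
        (ENNReal.half_pos (tsub_pos_of_lt (hlt T hT0 hTt)).ne')
      apply (iInf_le _ x).trans
      rw [kappa_one ht, kappa_one hs, hx, if_pos (hlt S hS0 hSt), if_pos]
      · simp
      · apply hx'.trans_lt
        calc T * (D / (T + S)) + (T - T * (D / (T + S))) / 2
            < T * (D / (T + S)) + (T - T * (D / (T + S))) :=
              ENNReal.add_lt_add_left (hlt T hT0 hTt).ne_top
                (ENNReal.half_lt_self (tsub_pos_of_lt (hlt T hT0 hTt)).ne'
                  (ENNReal.sub_ne_top hTt))
          _ = T := add_tsub_cancel_of_le (hlt T hT0 hTt).le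
    · exact le_top
  · have hval : kappa α t (T * (D / (T + S)) + 0) + kappa α s (S * (D / (T + S)))
        = kappa α (t + s) D := by
      have e (U : ℝ≥0∞) (h0 : U ≠ 0) (ht : U ≠ ⊤) : U * (D / (T + S)) / U = D / (T + S) := by
        rw [mul_comm, ENNReal.mul_div_cancel_right h0 ht]
      rw [add_zero, kappa_of_one_lt hα ht, kappa_of_one_lt hα hs, kappa_of_one_lt hα hts, hTS,
        ← hT, ← hS, e T hT0 hTt, e S hS0 hSt, ← add_mul, ENNReal.div_add_div_same]
    have hlim : Tendsto (fun ε ↦ kappa α t (T * (D / (T + S)) + ε)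
        + kappa α s (S * (D / (T + S)))) (𝓝[>] 0) (𝓝 (kappa α (t + s) D)) := by
      rw [← hval]
      have hc : Continuous fun ε ↦ kappa α t (T * (D / (T + S)) + ε)
          + kappa α s (S * (D / (T + S))) :=
        ((continuous_kappa hα ht).comp (continuous_const.add continuous_id)).add continuous_const
      exact (hc.tendsto 0).mono_left nhdsWithin_le_nhds
    refine ge_of_tendsto hlim ?_
    filter_upwards [self_mem_nhdsWithin] with ε hε
    obtain ⟨x, hx, hx'⟩ := hmid ε hε
    apply (iInf_le _ x).trans
    rw [hx]
    gcongr
    exact kappa_mono hα.le t hx'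

/-- The one-dimensional profiles form a semigroup for morphological convolution. -/
lemma morphConvReal_kappaReal {α : ℝ≥0∞} (hα : 1 ≤ α) (t s : ℝ≥0) (D : ℝ≥0∞) (hDt : D ≠ ⊤) :
    morphConvReal (kappaReal α t) (kappaReal α s) D.toReal = kappa α (t + s) D := by
  refine iInf_kappa_add_kappa hα t s (fun r : ℝ ↦ ENNReal.ofReal |D.toReal - r|)
    (fun r ↦ ENNReal.ofReal |r|) D (fun r ↦ ?_) ⟨D.toReal, ?_, ?_⟩ ⟨0, ?_, ?_⟩
    (fun _ p q hpq ε _ ↦ ?_)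
  · rw [← ENNReal.ofReal_add (abs_nonneg _) (abs_nonneg _), ENNReal.le_ofReal_iff_toReal_le hDt
      (by positivity)]
    calc D.toReal ≤ |(D.toReal - r) + r| := by simp
      _ ≤ _ := abs_add_le _ _
  · simp
  · simp [hDt]
  · simp [hDt]
  · simp
  · subst hpq
    obtain ⟨hp, hq⟩ := ENNReal.add_ne_top.1 hDt
    refine ⟨q.toReal, by simp [hq], ?_⟩
    simp [ENNReal.toReal_add hp hq, hp]

end Kappa

/-! ### Riemannian distance: near-geodesics, finiteness, left invariance. -/

section RiemannianLieGroup

open Set Filter Topology Manifold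

variable {E H G : Type*} [NormedAddCommGroup E] [NormedSpace ℝ E]
  [TopologicalSpace H] {I : ModelWithCorners ℝ E H} [TopologicalSpace G] [ChartedSpace H G]
  [Bundle.RiemannianBundle (fun x : G => TangentSpace I x)]

/-- Along any path, intermediate values of the distance to the end point are attained, at points
which are almost aligned with both ends. -/
lemma exists_riemannianEDist_eq_and_le [RegularSpace G] [IsManifold I 1 G]
    [IsContinuousRiemannianBundle E (fun x : G => TangentSpace I x)]
    {x y : G} {p q ε : ℝ≥0∞} (hpq : p + q = riemannianEDist I x y)
    (hfin : riemannianEDist I x y ≠ ⊤) (hε : 0 < ε) :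
    ∃ z : G, riemannianEDist I z y = q ∧ riemannianEDist I x z ≤ p + ε := by
  have hlt : riemannianEDist I x y < p + q + ε := by
    rw [hpq]; exact ENNReal.lt_add_right hfin hε.ne'
  obtain ⟨γ, hγ0, hγ1, hγ, hlen⟩ := exists_lt_of_riemannianEDist_lt hlt
  have hcont : ContinuousOn (fun u ↦ riemannianEDist I (γ u) y) (Icc 0 1) := by
    let : PseudoEMetricSpace G := .ofRiemannianMetric I G
    have : Continuous fun z : G ↦ edist z y := by fun_prop
    exact this.comp_continuousOn hγ.continuousOn
  have hq : q ∈ Icc (riemannianEDist I (γ 1) y) (riemannianEDist I (γ 0) y) := by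
    rw [hγ0, hγ1, riemannianEDist_self, ← hpq]
    exact ⟨zero_le, le_add_self⟩
  obtain ⟨u, hu, hu'⟩ := intermediate_value_Icc' zero_le_one hcont hq
  refine ⟨γ u, hu', ?_⟩
  have h1 : riemannianEDist I x (γ u) ≤ pathELength I γ 0 u :=
    riemannianEDist_le_pathELength (hγ.mono (Icc_subset_Icc_right hu.2)) hγ0 rfl hu.1
  have h2 : q ≤ pathELength I γ u 1 := by
    rw [← hu']
    exact riemannianEDist_le_pathELength (hγ.mono (Icc_subset_Icc_left hu.1)) rfl hγ1 hu.2
  have hqt : q ≠ ⊤ := (ENNReal.add_ne_top.1 (hpq ▸ hfin)).2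
  rw [← pathELength_add hu.1 hu.2] at hlen
  -- The rest of the curve has length at least `q`, so finite `q` cancels from the total length.
  have h3 : riemannianEDist I x (γ u) + q ≤ p + ε + q :=
    (add_le_add h1 h2).trans (hlen.le.trans (by rw [add_right_comm]))
  exact (ENNReal.add_le_add_iff_right hqt).1 h3

/-- Nearby points are at distance less than `1`, so the points at finite distance from `y` form a
clopen set. -/
lemma riemannianEDist_ne_top_of_mem_connectedComponent [IsManifold I 1 G]
    [IsContinuousRiemannianBundle E (fun x : G => TangentSpace I x)]
    {x y : G} (h : x ∈ connectedComponent y) : riemannianEDist I x y ≠ ⊤ := by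
  have hclopen : IsClopen {z : G | riemannianEDist I z y < ⊤} := by
    constructor
    · rw [← isOpen_compl_iff, isOpen_iff_mem_nhds]
      intro z hz
      filter_upwards [eventually_riemannianEDist_lt I z (c := 1) one_pos] with w hw hw'
      exact hz ((riemannianEDist_triangle (y := w)).trans_lt
        (ENNReal.add_lt_top.2 ⟨hw.trans ENNReal.one_lt_top, hw'⟩))
    · rw [isOpen_iff_mem_nhds]
      intro z hz
      filter_upwards [eventually_riemannianEDist_lt I z (c := 1) one_pos] with w hw
      rw [riemannianEDist_comm] at hw
      exact (riemannianEDist_triangle (y := z)).trans_lt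
        (ENNReal.add_lt_top.2 ⟨hw.trans ENNReal.one_lt_top, hz⟩)
  have hy : y ∈ {z : G | riemannianEDist I z y < ⊤} := by simp [riemannianEDist_self]
  exact (hclopen.connectedComponent_subset hy h : riemannianEDist I x y < ⊤).ne

lemma eq_of_riemannianEDist_eq_zero [T3Space G] [IsManifold I 1 G]
    [IsContinuousRiemannianBundle E (fun x : G => TangentSpace I x)]
    {x y : G} (h : riemannianEDist I x y = 0) : x = y := by
  let : EMetricSpace G := .ofRiemannianMetric I G
  exact edist_eq_zero.1 h

variable [Group G]

lemma IsLeftInvariantMetric.enorm_mfderiv_mul_left (hinv : IsLeftInvariantMetric (G := G) I)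
    (g h : G) (v : TangentSpace I h) : ‖mfderiv I I (fun x : G => g * x) h v‖ₑ = ‖v‖ₑ := by
  have : ‖mfderiv I I (fun x : G => g * x) h v‖ = ‖v‖ := by
    rw [@norm_eq_sqrt_real_inner (TangentSpace I (g * h)), norm_eq_sqrt_real_inner, hinv g h v]
  rw [← ofReal_norm, ← ofReal_norm, this]

variable [LieGroup I 1 G]

/-- A left translation carries curves to curves of the same length, by the chain rule. -/
lemma IsLeftInvariantMetric.riemannianEDist_mul_left_le
    (hinv : IsLeftInvariantMetric (G := G) I) (g x y : G) :
    riemannianEDist I (g * x) (g * y) ≤ riemannianEDist I x y := by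
  refine le_of_forall_gt fun r hr ↦ ?_
  obtain ⟨γ, hγ0, hγ1, hγ, hlen, -⟩ :=
    exists_lt_locally_constant_of_riemannianEDist_lt hr zero_lt_one
  have hmul : CMDiff 1 (fun x : G ↦ g * x) := contMDiff_mul_left
  have hle : riemannianEDist I (g * x) (g * y) ≤ pathELength I (fun u ↦ g * γ u) 0 1 :=
    riemannianEDist_le_pathELength (hmul.comp hγ).contMDiffOn (by simp [hγ0]) (by simp [hγ1])
      zero_le_one
  refine (hle.trans_eq ?_).trans_lt hlen
  rw [pathELength_eq_lintegral_mfderiv_Icc, pathELength_eq_lintegral_mfderiv_Icc]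
  congr 1
  ext u
  have hc := mfderiv_comp u (hmul.mdifferentiable one_ne_zero (γ u))
    (hγ.mdifferentiable one_ne_zero u)
  change ‖mfderiv 𝓘(ℝ, ℝ) I ((fun x : G ↦ g * x) ∘ γ) u 1‖ₑ = _
  rw [hc]
  exact hinv.enorm_mfderiv_mul_left g (γ u) _

lemma IsLeftInvariantMetric.riemannianEDist_mul_left
    (hinv : IsLeftInvariantMetric (G := G) I) (g x y : G) :
    riemannianEDist I (g * x) (g * y) = riemannianEDist I x y :=
  (hinv.riemannianEDist_mul_left_le g x y).antisymm <| by
    simpa using hinv.riemannianEDist_mul_left_le g⁻¹ (g * x) (g * y)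

end RiemannianLieGroup

/-- The delta is the time-zero profile of the distance because the distance separates points. -/
lemma morphKernel_eq_kappa {E H G : Type*} [NormedAddCommGroup E] [NormedSpace ℝ E]
    [TopologicalSpace H] {I : ModelWithCorners ℝ E H} [TopologicalSpace G] [T3Space G]
    [ChartedSpace H G] [Group G] [IsManifold I 1 G]
    [Bundle.RiemannianBundle (fun x : G => TangentSpace I x)]
    [IsContinuousRiemannianBundle E (fun x : G => TangentSpace I x)]
    (α : ℝ≥0∞) (t : ℝ≥0) (g : G) :
    morphKernel I α t g = kappa α t (Manifold.riemannianEDist I g 1) := by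
  unfold morphKernel
  split_ifs with h
  · obtain ⟨rfl, hα⟩ := h
    rw [kappa_zero_of_ne_top hα]
    by_cases hg : g = 1
    · simp [morphDelta, hg, Manifold.riemannianEDist_self]
    · rw [morphDelta, if_neg hg, if_neg (mt eq_of_riemannianEDist_eq_zero hg)]
  · rfl

theorem mainTheorem7 {E H G : Type*} [NormedAddCommGroup E] [NormedSpace ℝ E]
    [FiniteDimensional ℝ E] [TopologicalSpace H] (I : ModelWithCorners ℝ E H) [I.Boundaryless]
    [TopologicalSpace G] [T2Space G] [ChartedSpace H G] [Group G] [LieGroup I ∞ G]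
    [Bundle.RiemannianBundle (fun x : G => TangentSpace I x)]
    [IsContMDiffRiemannianBundle I ∞ E (fun x : G => TangentSpace I x)]
    (hinv : IsLeftInvariantMetric (G := G) I)
    (α : ℝ≥0∞) (hα : 1 ≤ α) (g : G) (t s : ℝ≥0) :
    morphConv (morphKernel I α t) (morphKernel I α s) g = morphKernel I α (t + s) g ∧
    (g ∈ connectedComponent (1 : G) →
      Manifold.riemannianEDist I g 1 ≠ ⊤ ∧
      morphKernel I α (t + s) g =
        morphConvReal (kappaReal α t) (kappaReal α s)
          (Manifold.riemannianEDist I g 1).toReal) := by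
  -- A Hausdorff topological group is regular, which supplies the `T3Space` instance.
  have : IsTopologicalGroup G := topologicalGroup_of_lieGroup I ∞
  have : LieGroup I 1 G := LieGroup.of_le (n := ∞) (by simp)
  have : IsContinuousRiemannianBundle E (fun x : G => TangentSpace I x) := by
    obtain ⟨m, hm, hm'⟩ := IsContMDiffRiemannianBundle.exists_contMDiff (IB := I) (n := ∞) (F := E)
      (E := fun x : G => TangentSpace I x)
    exact ⟨m, hm.continuous, hm'⟩
  simp only [morphConv, morphKernel_eq_kappa]
  have hd (h : G) : Manifold.riemannianEDist I (h⁻¹ * g) 1 = Manifold.riemannianEDist I g h := by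
    simpa using (hinv.riemannianEDist_mul_left h (h⁻¹ * g) 1).symm
  refine ⟨?_, fun hg ↦ ?_⟩
  · simp only [hd]
    exact iInf_kappa_add_kappa hα t s _ _ _ (fun h ↦ Manifold.riemannianEDist_triangle)
      ⟨g, Manifold.riemannianEDist_self, rfl⟩ ⟨1, rfl, Manifold.riemannianEDist_self⟩
      (fun hfin p q hpq ε hε ↦ exists_riemannianEDist_eq_and_le hpq hfin hε)
  · have hfin := riemannianEDist_ne_top_of_mem_connectedComponent (I := I) hg
    exact ⟨hfin, (morphConvReal_kappaReal hα t s _ hfin).symm⟩
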